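/- Let $K\ge 3$ and $N\ge 2$ be integers and let $\theta,p>0$ be real numbers. Consider the $N$-particle Fleming--Viot process on the cycle graph $\mathbb Z/K\mathbb Z$, that is, the continuous-time Markov chain on the finite state space $$\mathcal E_{K,N}=\Big\{\eta:\mathbb Z/K\mathbb Z\to\mathbb N:\ \sum_{k\in\mathbb Z/K\mathbb Z}\eta(k)=N\Big\}$$ with generator $$\mathcal L_{K,N}f(\eta)=\sum_{i,j\in\mathbb Z/K\mathbb Z}\eta(i)\,\big[f(\eta-e_i+e_j)-f(\eta)\big]\Big(\mathbf 1_{\{j=i+1\}}+\theta\,\mathbf 1_{\{j=i-1\}}+p\,\frac{\eta(j)}{N-1}\Big),$$ where $e_i$ is the $i$-th canonical vector and the terms with $\eta(i)=0$ are zero. This chain has a unique stationary distribution $\nu_N$, i.e. a unique probability measure on $\mathcal E_{K,N}$ such that $\int \mathcal L_{K,N}f\,d\nu_N=0$ for every $f:\mathcal E_{K,N}\to\mathbb R$. Under $\nu_N$, the covariance between the proportions of particles at two sites is a non-increasing function of the graph distance $d$ between these sites in the cycle graph: for all $i,j,i',j'\in\mathbb Z/K\mathbb Z$ with $d(i,j)\le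 d(i',j')$, $$\operatorname{Cov}_{\nu_N}\Big[\frac{\eta(i)}N,\frac{\eta(j)}N\Big]\ \ge\ \operatorname{Cov}_{\nu_N}\Big[\frac{\eta(i')}N,\frac{\eta(j')}N\Big].$$ In particular, for all $k=0,1,\dots,\lfloor K/2\rfloor-1$, $$\operatorname{Cov}_{\nu_N}\Big[\frac{\eta(0)}N,\frac{\eta(k)}N\Big]\ \ge\ \operatorname{Cov}_{\nu_N}\Big[\frac{\eta(0)}N,\frac{\eta(k+1)}N\Big].$$ -/

import Mathlib

open MeasureTheory ProbabilityTheory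
open scoped BigOperators

namespace FlemingViotCycle

/-- The state space: configurations of `N` indistinguishable particles on the sites
`ℤ/Kℤ`, a configuration `η` being given by the occupation numbers `η k`. -/
def Config (K N : ℕ) [NeZero K] : Type :=
  {η : ZMod K → ℕ // ∑ k, η k = N}

variable {K N : ℕ} [NeZero K]

instance : CoeFun (Config K N) (fun _ => ZMod K → ℕ) := ⟨Subtype.val⟩

/-- The state space is finite. -/
instance : Finite (Config K N) := by
  refine Finite.of_injective
    (fun (η : Config K N) (k : ZMod K) => (⟨η k, ?_⟩ : Fin (N + 1))) ?_
  · have h := Finset.single_le_sum (f := η.1) (fun i _ => Nat.zero_le _) (Finset.mem_univ k)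
    have h2 := η.2
    omega
  · intro η ξ h
    apply Subtype.ext
    funext k
    exact congrArg Fin.val (congrFun h k)

/-- Every subset of the (finite) state space is measurable. -/
instance : MeasurableSpace (Config K N) := ⊤

instance : DiscreteMeasurableSpace (Config K N) := ⟨fun _ => trivial⟩

/-- Removing a particle from an occupied site `i` and adding one at site `j` preserves the
number of particles. -/
theorem sum_move (η : Config K N) (i j : ZMod K) (h : 0 < η i) :
    ∑ k, (η k - (Pi.single i 1 : ZMod K → ℕ) k + (Pi.single j 1 : ZMod K → ℕ) k) = N := by
  have hle : ∀ k, (Pi.single i 1 : ZMod K → ℕ) k ≤ η k := by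
    intro k
    by_cases hk : k = i
    · subst hk
      rw [Pi.single_eq_same]
      exact h
    · simp [hk]
  have h1 : ∑ k, (η k - (Pi.single i 1 : ZMod K → ℕ) k)
      + ∑ k, (Pi.single i 1 : ZMod K → ℕ) k = N := by
    rw [← Finset.sum_add_distrib]
    exact (Finset.sum_congr rfl fun k _ => Nat.sub_add_cancel (hle k)).trans η.2
  have h2 : ∀ l : ZMod K, ∑ k, (Pi.single l 1 : ZMod K → ℕ) k = 1 := by
    intro l; simp
  rw [Finset.sum_add_distrib, h2]
  rw [h2] at h1
  exact h1

/-- `T_{i → j} η = η - e_i + e_j`, one particle moves from `i` to `j`. It is only meaningful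
when `η i > 0`; the other value is irrelevant, as the move then has rate `0`. -/
def move (i j : ZMod K) (η : Config K N) : Config K N :=
  if h : 0 < η i then
    ⟨fun k => η k - (Pi.single i 1 : ZMod K → ℕ) k + (Pi.single j 1 : ZMod K → ℕ) k,
      sum_move η i j h⟩
  else η

/-- The rate at which each single particle at site `i` jumps to site `j`, when the
configuration is `η`: rate `1` clockwise, rate `θ` anti-clockwise, and, with killing rate `p`,
a jump to the position of one of the `N - 1` other particles, chosen uniformly.
(For `j = i` the rate has no effect, since `move i i` changes nothing.) -/
noncomputable def jumpRate (θ p : ℝ) (η : Config K N) (i j : ZMod K) : ℝ :=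
  (if j = i + 1 then 1 else 0) + θ * (if j = i - 1 then 1 else 0)
    + p * ((η j : ℝ) / ((N : ℝ) - 1))

/-- The generator of the `N`-particle Fleming–Viot process on the `K`-cycle. -/
noncomputable def generator (θ p : ℝ) (f : Config K N → ℝ) (η : Config K N) : ℝ :=
  ∑ i, ∑ j, (η i : ℝ) * (f (move i j η) - f η) * jumpRate θ p η i j

/-- `ν` is a stationary distribution of the `N`-particle process: a probability measure on
the finite state space with `ν (L f) = 0` for every function `f`, `L` being the generator. -/
structure IsStationary (θ p : ℝ) (ν : Measure (Config K N)) : Prop where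
  isProbabilityMeasure : IsProbabilityMeasure ν
  integral_generator : ∀ f : Config K N → ℝ, ∫ η, generator θ p f η ∂ν = 0

/-- The proportion `η k / N` of particles at site `k`. -/
noncomputable def proportion (k : ZMod K) (η : Config K N) : ℝ := (η k : ℝ) / (N : ℝ)

/-- The cycle graph on `ℤ/Kℤ`: `a` and `b` are adjacent iff they differ by `± 1`
(and `a ≠ b`). -/
def cycle (K : ℕ) : SimpleGraph (ZMod K) := SimpleGraph.circulantGraph {1}

end FlemingViotCycle

/-! Uniqueness of the stationary law makes it rotation invariant, so with `S k = E[η(0) η(k)]` every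
covariance is an affine function of `S (j - i)`, and `S` is even. Testing stationarity on `η(0)
η(k)`, `k ≠ 0`, closes on second moments. Evenness merges the two drifts into a Laplacian: with `n =
E[η(0)]` and `q = p/(N-1)`, the function `t = S - n·1_{0}` satisfies `(1+θ) Δt = 2qS ≥ 0` off `0`.
An even function on the cycle that is convex off `0` decreases up to the antipode
(`antitone_first_half`), and hence so does `S` (`integral_mul_succ_le`). No explicit solution is
needed. -/

namespace FlemingViotCycle

variable {K N : ℕ} [NeZero K]

/-! ### Stationary vectors of finite Markov generators -/

/-- A finite Markov generator has a stationary probability vector. -/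
theorem exists_stationary_weight {X : Type*} [Fintype X] [DecidableEq X] [Nonempty X]
    (Q : Matrix X X ℝ) (hQ : ∀ x y, x ≠ y → 0 ≤ Q x y) (h0 : ∀ x, ∑ y, Q x y = 0) :
    ∃ w : X → ℝ, (∀ x, 0 ≤ w x) ∧ ∑ x, w x = 1 ∧ ∀ y, ∑ x, w x * Q x y = 0 := by
  have hdet : Q.det = 0 := by
    rw [← Matrix.exists_mulVec_eq_zero_iff]
    refine ⟨fun _ => 1, fun h => ?_, ?_⟩
    · exact one_ne_zero (congrFun h (Classical.arbitrary X))
    · funext x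
      simpa [Matrix.mulVec, dotProduct] using h0 x
  obtain ⟨v, hv, hvQ⟩ := Matrix.exists_vecMul_eq_zero_iff.2 hdet
  have hv' : ∀ y, ∑ x, v x * Q x y = 0 := fun y => by
    simpa [Matrix.vecMul, dotProduct] using congrFun hvQ y
  -- If `v` is a left null vector, so is `|v|`: by the triangle inequality each coordinate of `|v|
  -- Q` is nonnegative, and they sum to zero because the rows of `Q` do.
  have hnonneg : ∀ y, 0 ≤ ∑ x, |v x| * Q x y := by
    intro y
    have h1 := hv' y
    rw [← Finset.add_sum_erase _ _ (Finset.mem_univ y)] at h1 ⊢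
    have hdiag : Q y y ≤ 0 := by
      have h2 := h0 y
      rw [← Finset.add_sum_erase _ _ (Finset.mem_univ y)] at h2
      have : 0 ≤ ∑ z ∈ Finset.univ.erase y, Q y z :=
        Finset.sum_nonneg fun z hz => hQ _ _ (Finset.ne_of_mem_erase hz).symm
      linarith
    have h3 : |∑ x ∈ Finset.univ.erase y, v x * Q x y| ≤
        ∑ x ∈ Finset.univ.erase y, |v x| * Q x y := by
      refine (Finset.abs_sum_le_sum_abs _ _).trans (Finset.sum_le_sum fun x hx => ?_)
      rw [abs_mul, abs_of_nonneg (hQ x y (Finset.ne_of_mem_erase hx))]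
    have h4 : |∑ x ∈ Finset.univ.erase y, v x * Q x y| = -(|v y| * Q y y) := by
      rw [show ∑ x ∈ Finset.univ.erase y, v x * Q x y = -(v y * Q y y) by linarith, abs_neg,
        abs_mul, abs_of_nonpos hdiag]
      ring
    linarith
  have hsum : ∑ y, ∑ x, |v x| * Q x y = 0 := by
    rw [Finset.sum_comm]
    exact Finset.sum_eq_zero fun x _ => by rw [← Finset.mul_sum, h0, mul_zero]
  have hzero : ∀ y, ∑ x, |v x| * Q x y = 0 := fun y =>
    (Finset.sum_eq_zero_iff_of_nonneg fun y _ => hnonneg y).1 hsum y (Finset.mem_univ y)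
  obtain ⟨x₀, hx₀⟩ : ∃ x, v x ≠ 0 := by
    by_contra! h
    exact hv (funext h)
  have hpos : 0 < ∑ x, |v x| :=
    Finset.sum_pos' (fun _ _ => abs_nonneg _) ⟨x₀, Finset.mem_univ _, abs_pos.2 hx₀⟩
  refine ⟨fun x => |v x| / ∑ z, |v z|, fun x => div_nonneg (abs_nonneg _) hpos.le, ?_, fun y => ?_⟩
  · rw [← Finset.sum_div, div_self hpos.ne']
  · simp_rw [div_mul_eq_mul_div]
    rw [← Finset.sum_div, hzero, zero_div]

/-! ### Moves and the maximum principle -/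

/-- The configuration with all the particles at site `0`. -/
def concentrated (K N : ℕ) [NeZero K] : Config K N := ⟨Pi.single 0 N, by simp⟩

instance : Nonempty (Config K N) := ⟨concentrated K N⟩

theorem move_apply (i j k : ZMod K) (η : Config K N) (h : 0 < η i) :
    (move i j η k : ℝ) = η k - (if k = i then 1 else 0) + (if k = j then 1 else 0) := by
  have hle : (if k = i then 1 else 0) ≤ η k := by
    split_ifs with hk
    · subst hk; exact h
    · exact Nat.zero_le _
  have hm : move i j η k = η k - (if k = i then 1 else 0) + (if k = j then 1 else 0) := by
    have h0 : move i j η = ⟨fun k => η k - (Pi.single i 1 : ZMod K → ℕ) k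
        + (Pi.single j 1 : ZMod K → ℕ) k, sum_move η i j h⟩ := dif_pos h
    rw [h0]
    simp only [Pi.single_apply]
  rw [hm]
  push_cast [Nat.cast_sub hle]
  rfl

theorem jumpRate_nonneg (hN : 2 ≤ N) {θ p : ℝ} (hθ : 0 < θ) (hp : 0 < p) (η : Config K N)
    (i j : ZMod K) : 0 ≤ jumpRate θ p η i j := by
  have : (2 : ℝ) ≤ N := by exact_mod_cast hN
  have h : 0 ≤ (η j : ℝ) / ((N : ℝ) - 1) := div_nonneg (Nat.cast_nonneg _) (by linarith)
  unfold jumpRate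
  have := mul_nonneg hp.le h
  split_ifs <;> linarith

theorem one_le_jumpRate (hN : 2 ≤ N) {θ p : ℝ} (hθ : 0 < θ) (hp : 0 < p) (η : Config K N)
    (i : ZMod K) : 1 ≤ jumpRate θ p η i (i + 1) := by
  have : (2 : ℝ) ≤ N := by exact_mod_cast hN
  have h : 0 ≤ (η (i + 1) : ℝ) / ((N : ℝ) - 1) := div_nonneg (Nat.cast_nonneg _) (by linarith)
  unfold jumpRate
  have := mul_nonneg hp.le h
  rw [if_pos rfl]
  split_ifs <;> linarith

/-- The generator as a linear operator. -/
noncomputable def generatorLinear (θ p : ℝ) : (Config K N → ℝ) →ₗ[ℝ] (Config K N → ℝ) where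
  toFun := generator θ p
  map_add' f g := by
    funext η
    simp only [generator, Pi.add_apply, ← Finset.sum_add_distrib]
    exact Finset.sum_congr rfl fun i _ => Finset.sum_congr rfl fun j _ => by ring
  map_smul' c f := by
    funext η
    simp only [generator, Pi.smul_apply, smul_eq_mul, RingHom.id_apply, Finset.mul_sum]
    exact Finset.sum_congr rfl fun i _ => Finset.sum_congr rfl fun j _ => by ring

theorem generator_const (θ p c : ℝ) (η : Config K N) : generator θ p (fun _ => c) η = 0 := by
  simp [generator]

/-- Number of clockwise steps needed to bring all the particles to site `0`. -/
def height (η : Config K N) : ℕ := ∑ k, η k * (-k).val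

/-- A particle at `i ≠ 0` does not wrap around when it steps clockwise, so exactly one step is
saved. -/
theorem height_move_lt (hK : 3 ≤ K) (η : Config K N) (i : ZMod K) (hi : i ≠ 0) (h : 0 < η i) :
    height (move i (i + 1) η) < height η := by
  have hval : ((-(i + 1)).val : ℝ) + 1 = (-i).val := by
    have : Fact (1 < K) := ⟨by omega⟩
    have : -i ≠ 0 := neg_ne_zero.2 hi
    have h1 : -(i + 1) = -i - 1 := by ring
    have h2 : 0 < (-i).val := ZMod.val_pos.2 this
    have h3 : (-i - 1).val = (-i).val - (1 : ZMod K).val :=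
      ZMod.val_sub (by rw [ZMod.val_one]; exact h2)
    rw [h1, h3, ZMod.val_one]
    push_cast [Nat.cast_sub h2]
    ring
  have : (height (move i (i + 1) η) : ℝ) = height η - 1 := by
    unfold height
    push_cast
    simp_rw [move_apply i (i + 1) _ η h, add_mul, sub_mul, Finset.sum_add_distrib,
      Finset.sum_sub_distrib]
    simp only [ite_mul, one_mul, zero_mul, Finset.sum_ite_eq', Finset.mem_univ, if_true]
    simp only [ZMod.natCast_val] at hval ⊢
    linarith
  have h' : (height (move i (i + 1) η) : ℝ) < height η := by linarith
  exact_mod_cast h'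

theorem eq_concentrated (η : Config K N) (h : ∀ i, i ≠ 0 → η i = 0) : η = concentrated K N := by
  have h0 : η 0 = N := by
    have := η.2
    rwa [Finset.sum_eq_single 0 (fun i _ hi => h i hi) (by simp)] at this
  apply Subtype.ext
  funext k
  by_cases hk : k = 0
  · subst hk; simpa [concentrated] using h0
  · simpa [concentrated, hk] using h k hk

/-- At a maximum every term of the generator is nonpositive. As they sum to zero, each vanishes, and
the clockwise rate is positive. -/
theorem eq_of_generator_eq_zero_of_max (hN : 2 ≤ N) {θ p : ℝ} (hθ : 0 < θ) (hp : 0 < p)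
    {f : Config K N → ℝ} (hf : generator θ p f = 0) (η : Config K N) (hmax : ∀ ξ, f ξ ≤ f η)
    (i : ZMod K) (h : 0 < η i) : f (move i (i + 1) η) = f η := by
  have hterm : ∀ i j, (η i : ℝ) * (f (move i j η) - f η) * jumpRate θ p η i j ≤ 0 := fun i j =>
    mul_nonpos_of_nonpos_of_nonneg
      (mul_nonpos_of_nonneg_of_nonpos (Nat.cast_nonneg _) (sub_nonpos.2 (hmax _)))
      (jumpRate_nonneg hN hθ hp η i j)
  have h0 := congrFun hf η
  simp only [generator, Pi.zero_apply] at h0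
  have h1 := (Finset.sum_eq_zero_iff_of_nonpos fun i _ =>
    Finset.sum_nonpos fun j _ => hterm i j).1 h0 i (Finset.mem_univ i)
  have h2 := (Finset.sum_eq_zero_iff_of_nonpos fun j _ => hterm i j).1 h1 (i + 1)
    (Finset.mem_univ _)
  have h3 : (η i : ℝ) ≠ 0 := by exact_mod_cast h.ne'
  have h4 := one_le_jumpRate hN hθ hp η i
  have h5 : jumpRate θ p η i (i + 1) ≠ 0 := by linarith
  simpa [h3, h5, sub_eq_zero] using h2

/-- Clockwise moves carry a maximizer to other maximizers of smaller height, until all particles are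
at `0`. -/
theorem concentrated_max (hK : 3 ≤ K) (hN : 2 ≤ N) {θ p : ℝ} (hθ : 0 < θ) (hp : 0 < p)
    {f : Config K N → ℝ} (hf : generator θ p f = 0) (ξ : Config K N) :
    f ξ ≤ f (concentrated K N) := by
  have key : ∀ n, ∀ η : Config K N, height η = n → (∀ ξ, f ξ ≤ f η) →
      f η = f (concentrated K N) := by
    intro n
    induction n using Nat.strong_induction_on with
    | _ n ih =>
      intro η hn hmax
      by_cases h : ∀ i, i ≠ 0 → η i = 0
      · rw [← eq_concentrated η h]
      · push Not at h
        obtain ⟨i, hi, hηi⟩ := h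
        have hpos := Nat.pos_of_ne_zero hηi
        have hm := eq_of_generator_eq_zero_of_max hN hθ hp hf η hmax i hpos
        rw [← hm]
        exact ih _ (hn ▸ height_move_lt hK η i hi hpos) _ rfl (by rwa [hm])
  obtain ⟨η, hη⟩ := Finite.exists_max f
  rw [← key _ η rfl hη]
  exact hη ξ

/-- Harmonic functions of the process are constant. -/
theorem eq_const_of_generator_eq_zero (hK : 3 ≤ K) (hN : 2 ≤ N) {θ p : ℝ} (hθ : 0 < θ)
    (hp : 0 < p) {f : Config K N → ℝ} (hf : generator θ p f = 0) (ξ : Config K N) :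
    f ξ = f (concentrated K N) := by
  refine le_antisymm (concentrated_max hK hN hθ hp hf ξ) ?_
  have hneg : generator θ p (-f) = 0 := by
    have := (generatorLinear (K := K) (N := N) θ p).map_neg f
    change generator θ p (-f) = -generator θ p f at this
    rw [this, hf, neg_zero]
  have := concentrated_max hK hN hθ hp hneg ξ
  simpa using this

/-! ### Existence and uniqueness of the stationary distribution -/

theorem integrable_config (ν : Measure (Config K N)) [IsFiniteMeasure ν] (f : Config K N → ℝ) :
    Integrable f ν := .of_finite

theorem exists_isStationary (hN : 2 ≤ N) {θ p : ℝ} (hθ : 0 < θ) (hp : 0 < p) :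
    ∃ ν : Measure (Config K N), IsStationary θ p ν := by
  classical
  let : Fintype (Config K N) := Fintype.ofFinite _
  let Q : Matrix (Config K N) (Config K N) ℝ := fun η ξ => generator θ p (Pi.single ξ 1) η
  have hQf : ∀ f η, generator θ p f η = ∑ ξ, Q η ξ * f ξ := by
    intro f η
    have h1 : f = ∑ ξ, f ξ • (Pi.single ξ 1 : Config K N → ℝ) := by
      funext ζ; simp [Finset.sum_apply, Pi.single_apply]
    have h2 := congrArg (generatorLinear θ p) h1
    rw [map_sum] at h2
    have h3 := congrFun h2 η
    rw [Finset.sum_apply] at h3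
    refine h3.trans (Finset.sum_congr rfl fun ξ _ => ?_)
    rw [map_smul, Pi.smul_apply, smul_eq_mul, mul_comm]
    rfl
  obtain ⟨w, hw, hw1, hwQ⟩ := exists_stationary_weight Q (fun η ξ hne => by
      refine Finset.sum_nonneg fun i _ => Finset.sum_nonneg fun j _ =>
        mul_nonneg (mul_nonneg (Nat.cast_nonneg _) ?_) (jumpRate_nonneg hN hθ hp η i j)
      rw [Pi.single_eq_of_ne hne, sub_zero, Pi.single_apply]
      split_ifs <;> norm_num)
    (fun η => by simpa [generator_const] using (hQf (fun _ => 1) η).symm)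
  let P : PMF (Config K N) := PMF.ofFintype (fun η => ENNReal.ofReal (w η)) (by
    rw [← ENNReal.ofReal_sum_of_nonneg fun η _ => hw η, hw1, ENNReal.ofReal_one])
  refine ⟨P.toMeasure, inferInstance, fun f => ?_⟩
  rw [PMF.integral_eq_sum]
  have hP : ∀ η, (P η).toReal = w η := fun η => by
    simp [P, PMF.ofFintype_apply, ENNReal.toReal_ofReal (hw η)]
  simp_rw [hP, hQf, smul_eq_mul, Finset.mul_sum, ← mul_assoc]
  rw [Finset.sum_comm]
  refine Finset.sum_eq_zero fun ξ _ => ?_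
  rw [← Finset.sum_mul, hwQ, zero_mul]

/-- The operator `T f = L f + ν(f)` is injective: if `T f = 0`, integrating against `ν` gives `ν(f)
= 0`, so `f` is harmonic, hence constant, hence zero. In finite dimension `T` is then onto. Both `ν`
and `ν'` integrate `T f` to `ν(f)`, so they agree on every indicator. -/
theorem isStationary_unique (hK : 3 ≤ K) (hN : 2 ≤ N) {θ p : ℝ} (hθ : 0 < θ) (hp : 0 < p)
    {ν ν' : Measure (Config K N)} (h : IsStationary θ p ν) (h' : IsStationary θ p ν') :
    ν = ν' := by
  classical
  have := h.isProbabilityMeasure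
  have := h'.isProbabilityMeasure
  let T : (Config K N → ℝ) →ₗ[ℝ] (Config K N → ℝ) :=
    { toFun := fun f η => generator θ p f η + ∫ ξ, f ξ ∂ν
      map_add' := fun f g => by
        funext η
        have h1 := congrFun ((generatorLinear (K := K) (N := N) θ p).map_add f g) η
        change generator θ p (f + g) η = generator θ p f η + generator θ p g η at h1
        have h2 := integral_add (integrable_config ν f) (integrable_config ν g)
        simp only [Pi.add_apply, h1, h2]
        ring
      map_smul' := fun c f => by
        funext η
        have h1 := congrFun ((generatorLinear (K := K) (N := N) θ p).map_smul c f) η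
        change generator θ p (c • f) η = c * generator θ p f η at h1
        simp only [Pi.smul_apply, smul_eq_mul, h1, integral_const_mul, RingHom.id_apply]
        ring }
  have hT : ∀ f η, T f η = generator θ p f η + ∫ ξ, f ξ ∂ν := fun _ _ => rfl
  have hint : ∀ (μ : Measure (Config K N)), IsStationary θ p μ → ∀ f,
      ∫ η, T f η ∂μ = ∫ ξ, f ξ ∂ν := by
    intro μ hμ f
    have := hμ.isProbabilityMeasure
    simp_rw [hT]
    rw [integral_add (integrable_config μ _) (integrable_config μ _), hμ.integral_generator]
    simp
  have hinj : Function.Injective T := by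
    rw [injective_iff_map_eq_zero]
    intro f hf
    have h0 : ∫ ξ, f ξ ∂ν = 0 := by
      rw [← hint ν h f, hf]; simp
    have hgen : generator θ p f = 0 := by
      funext η
      have := hT f η
      rw [hf, h0, add_zero] at this
      exact this.symm
    have hc := eq_const_of_generator_eq_zero hK hN hθ hp hgen
    have h1 : f (concentrated K N) = 0 := by
      rw [integral_congr_ae (Filter.Eventually.of_forall hc)] at h0
      simpa using h0
    funext η
    rw [hc, h1]; rfl
  have hsurj := LinearMap.injective_iff_surjective.1 hinj
  refine Measure.ext_of_singleton fun η => ?_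
  obtain ⟨g, hg⟩ := hsurj (Set.indicator {η} fun _ => 1)
  have h1 := hint ν h g
  have h2 := hint ν' h' g
  rw [hg, integral_indicator (measurableSet_singleton η)] at h1 h2
  simp only [integral_const, smul_eq_mul, mul_one, measureReal_restrict_apply_univ] at h1 h2
  exact (measureReal_eq_measureReal_iff).1 (h1.trans h2.symm)

/-! ### Distance in the cycle graph -/

theorem cycle_adj_add_one {K : ℕ} (hK : 3 ≤ K) (i : ZMod K) : (cycle K).Adj i (i + 1) := by
  have : Fact (1 < K) := ⟨by omega⟩
  simp [cycle]

/-- The distance in the cycle graph. -/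
theorem cycle_dist (hK : 3 ≤ K) (i j : ZMod K) :
    (cycle K).dist i j = (j - i).valMinAbs.natAbs := by
  -- Each edge changes the displacement by `±1`, and `natAbs` of `valMinAbs` is subadditive.
  have hlow : ∀ {i j : ZMod K} (w : (cycle K).Walk i j), (j - i).valMinAbs.natAbs ≤ w.length := by
    intro i j w
    induction w with
    | nil => simp
    | @cons u v z h q ih =>
      have h1 : (v - u).valMinAbs.natAbs ≤ 1 := by
        have hone : (1 : ZMod K).valMinAbs.natAbs ≤ 1 := by
          have : Fact (1 < K) := ⟨by omega⟩
          rw [ZMod.valMinAbs_natAbs_eq_min, ZMod.val_one]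
          exact min_le_left _ _
        have h2 : u - v = 1 ∨ v - u = 1 := by simpa [cycle, h.ne] using h
        rcases h2 with h2 | h2
        · rw [← neg_sub, ZMod.natAbs_valMinAbs_neg, h2]; exact hone
        · rw [h2]; exact hone
      have h2 := ZMod.natAbs_valMinAbs_add_le (z - v) (v - u)
      rw [sub_add_sub_cancel] at h2
      have h3 := Int.natAbs_add_le (z - v).valMinAbs (v - u).valMinAbs
      rw [SimpleGraph.Walk.length_cons]
      omega
  have hup : ∀ (m : ℕ) (i : ZMod K), ∃ w : (cycle K).Walk i (i + m), w.length = m := by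
    intro m
    induction m with
    | zero => intro i; exact ⟨(SimpleGraph.Walk.nil : (cycle K).Walk i i).copy rfl (by simp), by simp⟩
    | succ m ih =>
      intro i
      obtain ⟨w, hw⟩ := ih (i + 1)
      exact ⟨(SimpleGraph.Walk.cons (cycle_adj_add_one hK i) w).copy rfl (by push_cast; ring),
        by simp [hw]⟩
  have hle : ∀ i j : ZMod K, (cycle K).dist i j ≤ (j - i).val := by
    intro i j
    obtain ⟨w, hw⟩ := hup (j - i).val i
    have := SimpleGraph.dist_le w
    rw [hw] at this
    simpa using this
  have hreach : (cycle K).Reachable i j := by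
    obtain ⟨w, -⟩ := hup (j - i).val i
    exact ⟨w.copy rfl (by simp)⟩
  apply le_antisymm
  · rw [ZMod.valMinAbs_natAbs_eq_min]
    refine le_min (hle i j) ?_
    by_cases h : j - i = 0
    · rw [sub_eq_zero.1 h]; simp
    · have h1 := hle j i
      have : NeZero (j - i) := ⟨h⟩
      rwa [SimpleGraph.dist_comm, ← neg_sub, ZMod.val_neg_of_ne_zero] at h1
  · obtain ⟨w, hw⟩ := hreach.exists_walk_length_eq_dist
    rw [← hw]
    exact hlow w

/-! ### Rotation invariance -/

/-- Rotation of a configuration by `c`. -/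
def rotate (c : ZMod K) (η : Config K N) : Config K N :=
  ⟨fun k => η (k + c), (Equiv.sum_comp (Equiv.addRight c) η.1).trans η.2⟩

theorem rotate_apply (c k : ZMod K) (η : Config K N) : rotate c η k = η (k + c) := rfl

theorem move_rotate (c i j : ZMod K) (η : Config K N) :
    move i j (rotate c η) = rotate c (move (i + c) (j + c) η) := by
  by_cases h : 0 < η (i + c)
  · have h' : 0 < rotate c η i := h
    apply Subtype.ext
    funext k
    have h1 := move_apply i j k _ h'
    have h2 := move_apply (i + c) (j + c) (k + c) _ h
    have h3 : (move i j (rotate c η) k : ℝ) = rotate c (move (i + c) (j + c) η) k := by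
      rw [h1, rotate_apply, rotate_apply, h2]
      simp only [add_left_inj]
    exact_mod_cast h3
  · have h' : ¬ 0 < rotate c η i := h
    have h1 : move i j (rotate c η) = rotate c η := dif_neg h'
    have h2 : move (i + c) (j + c) η = η := dif_neg h
    rw [h1, h2]

theorem generator_rotate (θ p : ℝ) (c : ZMod K) (f : Config K N → ℝ) (η : Config K N) :
    generator θ p f (rotate c η) = generator θ p (fun ξ => f (rotate c ξ)) η := by
  unfold generator
  refine Fintype.sum_equiv (Equiv.addRight c) _ _ fun i =>
    Fintype.sum_equiv (Equiv.addRight c) _ _ fun j => ?_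
  have h1 : (j + c = i + c + 1) ↔ j = i + 1 := by
    rw [add_right_comm, add_left_inj]
  have h2 : (j + c = i + c - 1) ↔ j = i - 1 := by
    rw [add_sub_right_comm, add_left_inj]
  simp only [Equiv.coe_addRight, move_rotate, jumpRate, rotate_apply, h1, h2]

/-- The generator commutes with rotations, so the rotated law is stationary too, and uniqueness
applies. -/
theorem map_rotate (hK : 3 ≤ K) (hN : 2 ≤ N) {θ p : ℝ} (hθ : 0 < θ) (hp : 0 < p)
    {ν : Measure (Config K N)} (h : IsStationary θ p ν) (c : ZMod K) :
    ν.map (rotate c) = ν := by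
  have hm : AEMeasurable (rotate c : Config K N → Config K N) ν :=
    (measurable_of_finite _).aemeasurable
  have := h.isProbabilityMeasure
  refine isStationary_unique hK hN hθ hp ⟨Measure.isProbabilityMeasure_map hm, fun f => ?_⟩ h
  rw [integral_map hm (measurable_of_finite _).aestronglyMeasurable]
  simp_rw [generator_rotate]
  exact h.integral_generator _

theorem integral_rotate (hK : 3 ≤ K) (hN : 2 ≤ N) {θ p : ℝ} (hθ : 0 < θ) (hp : 0 < p)
    {ν : Measure (Config K N)} (h : IsStationary θ p ν) (c : ZMod K) (f : Config K N → ℝ) :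
    ∫ η, f (rotate c η) ∂ν = ∫ η, f η ∂ν := by
  have hm : AEMeasurable (rotate c : Config K N → Config K N) ν :=
    (measurable_of_finite _).aemeasurable
  conv_rhs => rw [← map_rotate hK hN hθ hp h c]
  rw [integral_map hm (measurable_of_finite _).aestronglyMeasurable]

/-! ### Second moments and convexity -/

theorem cast_sum (η : Config K N) : ∑ k, (η k : ℝ) = N := by
  exact_mod_cast η.2

/-- The generator acting on a product of two occupation numbers. -/
theorem generator_mul (θ p : ℝ) (a b : ZMod K) (hab : a ≠ b) (η : Config K N) :
    generator θ p (fun ξ => (ξ a : ℝ) * ξ b) η =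
      η a * (η (b - 1) + θ * η (b + 1) - (1 + θ) * η b)
      + η b * (η (a - 1) + θ * η (a + 1) - (1 + θ) * η a)
      - η a * jumpRate θ p η a b - η b * jumpRate θ p η b a := by
  set r := jumpRate θ p η with hr
  set q : ℝ := p / ((N : ℝ) - 1) with hq
  have hrij : ∀ i j, r i j = (if j = i + 1 then 1 else 0) + θ * (if j = i - 1 then 1 else 0)
      + q * η j := fun i j => by rw [hr, hq, jumpRate]; ring
  -- The killing terms `q * N` in the outflow and in the inflow cancel in the end.
  have hout : ∀ i, ∑ j, r i j = 1 + θ + q * N := by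
    intro i
    simp only [hrij, Finset.sum_add_distrib, ← Finset.mul_sum, cast_sum]
    simp
  have hin : ∀ j, ∑ i, (η i : ℝ) * r i j = η (j - 1) + θ * η (j + 1) + q * N * η j := by
    intro j
    have h1 : ∀ i, (j = i + 1) ↔ i = j - 1 := fun i => by
      rw [eq_sub_iff_add_eq, eq_comm]
    have h2 : ∀ i, (j = i - 1) ↔ i = j + 1 := fun i => by
      rw [eq_sub_iff_add_eq, eq_comm]
    have h3 : ∀ i, (η i : ℝ) * r i j = (if i = j - 1 then (η i : ℝ) else 0)
        + θ * (if i = j + 1 then (η i : ℝ) else 0) + q * η j * η i := fun i => by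
      rw [hrij]; simp only [h1, h2]; split_ifs <;> ring
    simp only [h3, Finset.sum_add_distrib, ← Finset.mul_sum, cast_sum, Finset.sum_ite_eq',
      Finset.mem_univ, if_true]
    ring
  -- Product rule for increments: the last two terms are the product of the two increments, nonzero
  -- only for a jump between `a` and `b`.
  have hterm : ∀ i j, (η i : ℝ) * ((move i j η a : ℝ) * move i j η b - η a * η b) * r i j =
      (if b = j then η a * (η i * r i j) else 0) - (if b = i then η a * (η i * r i j) else 0)
      + ((if a = j then η b * (η i * r i j) else 0) - (if a = i then η b * (η i * r i j) else 0))
      - (if a = i then (if b = j then η i * r i j else 0) else 0)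
      - (if b = i then (if a = j then η i * r i j else 0) else 0) := by
    intro i j
    rcases Nat.eq_zero_or_pos (η i) with h | h
    · simp [h]
    · rw [move_apply i j a η h, move_apply i j b η h]
      split_ifs <;> first | (exfalso; apply hab; simp_all; done) | ring
  unfold generator
  simp only [← hr, hterm, Finset.sum_add_distrib, Finset.sum_sub_distrib]
  have e1 : ∀ c d : ZMod K, ∑ i, ∑ j, (if d = j then (η c : ℝ) * (η i * r i j) else 0) =
      η c * (η (d - 1) + θ * η (d + 1) + q * N * η d) := fun c d => by
    simp [← Finset.mul_sum, hin]
  have e2 : ∀ c d : ZMod K, ∑ i, ∑ j, (if d = i then (η c : ℝ) * (η i * r i j) else 0) =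
      η c * (η d * (1 + θ + q * N)) := fun c d => by
    rw [Finset.sum_comm]
    simp [← Finset.mul_sum, hout]
  have e3 : ∀ c d : ZMod K, ∑ i, ∑ j, (if c = i then (if d = j then (η i : ℝ) * r i j else 0)
      else 0) = η c * r c d := fun c d => by
    rw [Finset.sum_comm]; simp
  rw [e1, e1, e2, e2, e3, e3]
  ring

/-- A nonnegative sequence on `0, …, K`, symmetric and convex in the interior, is
nonincreasing on the first half. -/
theorem antitone_first_half {K : ℕ} (t : ℕ → ℝ) (hsymm : ∀ m ≤ K, t (K - m) = t m)
    (hconv : ∀ m, 0 < m → m < K → 0 ≤ t (m - 1) + t (m + 1) - 2 * t m) {m : ℕ}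
    (hm : 2 * m + 1 ≤ K) : t (m + 1) ≤ t m := by
  have key : ∀ n, m + n < K → t (m + 1) - t m ≤ t (m + n + 1) - t (m + n) := by
    intro n
    induction n with
    | zero => intro _; exact le_rfl
    | succ n ih =>
      intro h
      have h1 := ih (by omega)
      have h2 := hconv (m + n + 1) (by omega) (by omega)
      rw [Nat.add_sub_cancel] at h2
      rw [← add_assoc]
      linarith
  -- Increments are nondecreasing. The one at `m` is compared with its mirror image at `K - 1 - m`,
  -- which by symmetry is its opposite.
  have h := key (K - 1 - m - m) (by omega)
  have e1 : m + (K - 1 - m - m) + 1 = K - m := by omega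
  have e2 : m + (K - 1 - m - m) = K - (m + 1) := by omega
  rw [e1, e2, hsymm m (by omega), hsymm (m + 1) (by omega)] at h
  linarith

/-- The stationary second moments are nonincreasing in the displacement, up to half the
length of the cycle. -/
theorem integral_mul_succ_le (hK : 3 ≤ K) (hN : 2 ≤ N) {θ p : ℝ} (hθ : 0 < θ) (hp : 0 < p)
    {ν : Measure (Config K N)} (h : IsStationary θ p ν) {m : ℕ} (hm : 2 * m + 1 ≤ K) :
    ∫ η, (η 0 : ℝ) * η ((m + 1 : ℕ) : ZMod K) ∂ν ≤ ∫ η, (η 0 : ℝ) * η (m : ZMod K) ∂ν := by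
  have := h.isProbabilityMeasure
  set S : ZMod K → ℝ := fun k => ∫ η, (η 0 : ℝ) * η k ∂ν with hS
  set n : ℝ := ∫ η, (η 0 : ℝ) ∂ν with hn
  have hS' : ∀ a b, ∫ η, (η a : ℝ) * η b ∂ν = S (b - a) := fun a b => by
    rw [hS]
    dsimp only
    rw [← integral_rotate hK hN hθ hp h a (fun η => (η 0 : ℝ) * η (b - a))]
    simp [rotate_apply]
  have hn' : ∀ a, ∫ η, (η a : ℝ) ∂ν = n := fun a => by
    rw [hn, ← integral_rotate hK hN hθ hp h a (fun η => (η 0 : ℝ))]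
    simp [rotate_apply]
  have hneg : ∀ k, S (-k) = S k := fun k => by
    have h1 := hS' k 0
    rw [zero_sub] at h1
    rw [← h1, hS]
    simp_rw [mul_comm]
  have hN' : (0 : ℝ) < N - 1 := by
    have : (2 : ℝ) ≤ N := by exact_mod_cast hN
    linarith
  set q : ℝ := p / ((N : ℝ) - 1) with hq
  have hq0 : 0 < q := div_pos hp hN'
  have hpos : ∀ k, 0 ≤ S k := fun k => integral_nonneg fun η => by positivity
  -- The sources at `±1` come from direct jumps between the sites `0` and `k`.
  have hsys : ∀ k, k ≠ 0 → (1 + θ) * (S (k - 1) + S (k + 1) - 2 * S k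
      - (if k = 1 then n else 0) - (if k = -1 then n else 0)) = 2 * q * S k := by
    intro k hk
    have h0 := h.integral_generator (fun ξ => (ξ 0 : ℝ) * ξ k)
    have hexp : ∀ η : Config K N, generator θ p (fun ξ => (ξ 0 : ℝ) * ξ k) η =
        (η 0 : ℝ) * η (k - 1) + θ * ((η 0 : ℝ) * η (k + 1)) - 2 * (1 + θ + q) * ((η 0 : ℝ) * η k)
        + (η k : ℝ) * η (-1) + θ * ((η k : ℝ) * η 1)
        - ((if k = 1 then 1 else 0) + θ * (if k = -1 then 1 else 0)) * η 0
        - ((if k = -1 then 1 else 0) + θ * (if k = 1 then 1 else 0)) * η k := by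
      intro η
      rw [generator_mul θ p 0 k hk.symm η, jumpRate, jumpRate]
      have h1 : (0 : ZMod K) = k + 1 ↔ k = -1 := by rw [eq_comm, ← eq_neg_iff_add_eq_zero]
      have h2 : (0 : ZMod K) = k - 1 ↔ k = 1 := by rw [eq_comm, sub_eq_zero]
      simp only [h1, h2, zero_add, zero_sub]
      rw [hq]
      ring
    simp_rw [hexp] at h0
    have hi := integrable_config ν
    rw [integral_sub (hi _) (hi _), integral_sub (hi _) (hi _), integral_add (hi _) (hi _),
      integral_add (hi _) (hi _), integral_sub (hi _) (hi _), integral_add (hi _) (hi _)] at h0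
    simp only [integral_const_mul, hS', hn'] at h0
    have e1 : S (-1 - k) = S (k + 1) := by rw [← hneg]; congr 1; ring
    have e2 : S (1 - k) = S (k - 1) := by rw [← hneg]; congr 1; ring
    simp only [sub_zero, e1, e2] at h0
    split_ifs at h0 ⊢ <;> linarith
  have hdiag : n ≤ S 0 := integral_mono (integrable_config ν _) (integrable_config ν _) fun η => by
    have : η 0 ≤ η 0 * η 0 := Nat.le_mul_self _
    show (η 0 : ℝ) ≤ η 0 * η 0
    exact_mod_cast this
  -- Lowering the value at `0` by `n` absorbs the sources at `±1` into the Laplacian.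
  set t : ZMod K → ℝ := fun k => S k - if k = 0 then n else 0 with ht
  have hconv : ∀ k, k ≠ 0 → 0 ≤ t (k - 1) + t (k + 1) - 2 * t k := by
    intro k hk
    have h1 := hsys k hk
    have h2 : 0 ≤ (1 + θ) * (S (k - 1) + S (k + 1) - 2 * S k
      - (if k = 1 then n else 0) - (if k = -1 then n else 0)) := by
      rw [h1]; have := hpos k; positivity
    have h3 := nonneg_of_mul_nonneg_right h2 (by linarith)
    simp only [ht, sub_eq_zero, ← eq_neg_iff_add_eq_zero, hk, if_false]
    linarith
  have hanti := antitone_first_half (K := K) (fun m => t (m : ZMod K))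
    (fun m hm => by
      have : ((K - m : ℕ) : ZMod K) = -(m : ZMod K) := by
        rw [Nat.cast_sub hm]; simp
      simp only [this, ht, hneg, neg_eq_zero])
    (fun m h0 hm => by
      have hne : (m : ZMod K) ≠ 0 := fun h => by
        rw [ZMod.natCast_eq_zero_iff] at h
        exact absurd (Nat.le_of_dvd h0 h) (by omega)
      have := hconv m hne
      simpa [Nat.cast_sub (show 1 ≤ m from h0)] using this) hm
  have hn0 : 0 ≤ n := integral_nonneg fun η => Nat.cast_nonneg _
  have hne : ((m + 1 : ℕ) : ZMod K) ≠ 0 := fun h => by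
    rw [ZMod.natCast_eq_zero_iff] at h
    exact absurd (Nat.le_of_dvd (by omega) h) (by omega)
  simp only [ht, hne, if_false] at hanti
  change S _ ≤ S _
  -- The correction enters only at `m = 0`, where `n ≥ 0` works in favour of the inequality.
  split_ifs at hanti <;> linarith

/-- By rotation invariance the means agree and the mixed moment depends only on `j - i`. Exchanging
the factors makes it even in `j - i`, so the absolute displacement suffices. -/
theorem cov_proportion (hK : 3 ≤ K) (hN : 2 ≤ N) {θ p : ℝ} (hθ : 0 < θ) (hp : 0 < p)
    {ν : Measure (Config K N)} (h : IsStationary θ p ν) (i j : ZMod K) :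
    cov[proportion i, proportion j; ν] =
      (∫ η, (η 0 : ℝ) * η ((j - i).valMinAbs.natAbs : ZMod K) ∂ν) / (N : ℝ) ^ 2
        - (∫ η, proportion 0 η ∂ν) ^ 2 := by
  have := h.isProbabilityMeasure
  have hmem : ∀ k, MemLp (proportion k : Config K N → ℝ) 2 ν := fun k => .of_discrete
  have hmean : ∀ a, ∫ η, proportion a η ∂ν = ∫ η, proportion 0 η ∂ν := fun a => by
    rw [← integral_rotate hK hN hθ hp h a (proportion 0)]
    simp [proportion, rotate_apply]
  have hS : ∀ a b, ∫ η, (η a : ℝ) * η b ∂ν = ∫ η, (η 0 : ℝ) * η (b - a) ∂ν := fun a b => by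
    rw [← integral_rotate hK hN hθ hp h a (fun η => (η 0 : ℝ) * η (b - a))]
    simp [rotate_apply]
  rw [covariance_eq_sub (hmem i) (hmem j), hmean i, hmean j, ← sq]
  congr 1
  have h1 : ∫ η, proportion i η * proportion j η ∂ν = (∫ η, (η i : ℝ) * η j ∂ν) / (N : ℝ) ^ 2 := by
    rw [← integral_div]
    refine integral_congr_ae (Filter.Eventually.of_forall fun η => ?_)
    simp only [proportion]
    ring
  simp only [Pi.mul_apply]
  rw [h1, hS i j, ZMod.natCast_natAbs_valMinAbs]
  split_ifs
  · rfl
  · have h2 := hS j i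
    rw [neg_sub, ← h2, ← hS i j]
    simp_rw [mul_comm]

end FlemingViotCycle

theorem mainTheorem8 (K N : ℕ) [NeZero K] (hK : 3 ≤ K) (hN : 2 ≤ N)
    (θ p : ℝ) (hθ : 0 < θ) (hp : 0 < p) :
    (∃! ν : Measure (FlemingViotCycle.Config K N), FlemingViotCycle.IsStationary θ p ν) ∧
    ∀ ν : Measure (FlemingViotCycle.Config K N), FlemingViotCycle.IsStationary θ p ν →
      (∀ i j i' j' : ZMod K,
        (FlemingViotCycle.cycle K).dist i j ≤ (FlemingViotCycle.cycle K).dist i' j' →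
        cov[FlemingViotCycle.proportion i', FlemingViotCycle.proportion j'; ν] ≤
          cov[FlemingViotCycle.proportion i, FlemingViotCycle.proportion j; ν]) ∧
      (∀ k : ℕ, k + 1 ≤ K / 2 →
        cov[FlemingViotCycle.proportion 0, FlemingViotCycle.proportion ((k + 1 : ℕ) : ZMod K); ν] ≤
          cov[FlemingViotCycle.proportion 0, FlemingViotCycle.proportion (k : ZMod K); ν]) := by
  obtain ⟨μ, hμ⟩ := FlemingViotCycle.exists_isStationary (K := K) hN hθ hp
  refine ⟨⟨μ, hμ, fun ν hν => FlemingViotCycle.isStationary_unique hK hN hθ hp hν hμ⟩,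
    fun ν hν => ?_⟩
  have hdist : ∀ i j i' j' : ZMod K,
      (FlemingViotCycle.cycle K).dist i j ≤ (FlemingViotCycle.cycle K).dist i' j' →
      cov[FlemingViotCycle.proportion i', FlemingViotCycle.proportion j'; ν] ≤
        cov[FlemingViotCycle.proportion i, FlemingViotCycle.proportion j; ν] := by
    intro i j i' j' h
    rw [FlemingViotCycle.cycle_dist hK, FlemingViotCycle.cycle_dist hK] at h
    rw [FlemingViotCycle.cov_proportion hK hN hθ hp hν,
      FlemingViotCycle.cov_proportion hK hN hθ hp hν]
    have hle := ZMod.natAbs_valMinAbs_le (j' - i')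
    have hmono : ∀ a b : ℕ, a ≤ b → b ≤ K / 2 →
        ∫ η, (η 0 : ℝ) * η (b : ZMod K) ∂ν ≤ ∫ η, (η 0 : ℝ) * η (a : ZMod K) ∂ν := by
      intro a b hab
      induction b, hab using Nat.le_induction with
      | base => intro _; exact le_rfl
      | succ b _ ih =>
        intro hb
        exact (FlemingViotCycle.integral_mul_succ_le hK hN hθ hp hν (by omega)).trans
          (ih (by omega))
    exact sub_le_sub_right (div_le_div_of_nonneg_right (hmono _ _ h hle) (by positivity)) _
  refine ⟨hdist, fun k hk => hdist _ _ _ _ ?_⟩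
  rw [FlemingViotCycle.cycle_dist hK, FlemingViotCycle.cycle_dist hK, sub_zero, sub_zero,
    ZMod.valMinAbs_natCast_of_le_half hk, ZMod.valMinAbs_natCast_of_le_half (by omega)]
  omega
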